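/- Let $X$ be a measurable space and let $\mathcal{H}\subseteq\{0,1\}^X$ be a class of measurable hypotheses. A complete binary tree of depth $T$ has its internal nodes labelled; a branch is a root-to-leaf path, going right ($y=1$) or left ($y=0$) at each of the $T$ nodes on it. A complete tree labelled by points of $X$ is shattered by $\mathcal{H}$ if for every branch there is an $h\in\mathcal{H}$ with $h(x)=y$ for every node label $x$ on the branch and the direction $y$ taken there; $\mathsf{Ldim}(\mathcal{H})$ is the maximal depth of such a tree. For $\epsilon\in[0,\frac12)$, a probability distribution $P$ over $X$ is $\epsilon$-good (with respect to $\mathcal{H}$) if $\Pr_{x\sim P}[h(x)=1]\in[0,\epsilon]\cup[1-\epsilon,1]$ for every $h\in\mathcal{H}$. An $\epsilon$-good tree is a binary tree whose nodes are labelled by $\epsilon$-good distributions; a complete $\epsilon$-good tree is shattered by $\mathcal{H}$ if for every branch there is an $h\in\mathcal{H}$ such that $\Pr_{x\sim P}[h(x)=y]\ge 1-\epsilon$ for every node label $P$ on the branch and the direction $y$ taken there. Let $d_\epsilon$ denote the maximal depth of a complete $\epsilon$-good tree which is shattered by $\mathcal{H}$. (For $\mathcal{H}=\emptyset$, both maxima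 are read as $0$.) There is a universal constant $C>0$ such that, for every such $X$ and $\mathcal{H}$ with $\mathsf{Ldim}(\mathcal{H})=d<\infty$, one has $d_0=d$, and for every $\epsilon\in[0,\frac12)$ the number $d_\epsilon$ is finite and $$d_\epsilon\le C\cdot\frac{d}{(\frac12-\epsilon)^2}.$$ -/

import Mathlib

open MeasureTheory

namespace GoodTree

/-- Complete binary trees of depth `T` whose internal nodes are labelled by elements of `α`. -/
inductive CompleteTree (α : Type*) : ℕ → Type _
  | leaf : CompleteTree α 0
  | node {T : ℕ} (a : α) (left right : CompleteTree α T) : CompleteTree α (T + 1)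

/-- The branch (root-to-leaf path) of the tree given by the directions `y`, as the list of pairs
(label of the node, direction taken at that node); `true` means right and `false` means left. -/
def CompleteTree.branch {α : Type*} :
    {T : ℕ} → CompleteTree α T → (Fin T → Bool) → List (α × Bool)
  | _, .leaf, _ => []
  | _, .node a l r, y =>
      (a, y 0) :: bif y 0 then r.branch (Fin.tail y) else l.branch (Fin.tail y)

/-- Every branch of the tree is realized by some `h ∈ H`, where `R h a y` says that at a node
labelled `a` the hypothesis `h` goes in direction `y`. -/
def CompleteTree.Shattered {X α : Type*} {T : ℕ} (t : CompleteTree α T)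
    (R : (X → Bool) → α → Bool → Prop) (H : Set (X → Bool)) : Prop :=
  ∀ y : Fin T → Bool, ∃ h ∈ H, ∀ p ∈ t.branch y, R h p.1 p.2

/-- The Littlestone dimension of `H`: the supremum of the depths of the complete `X`-labelled
binary trees that are shattered by `H`. -/
noncomputable def Ldim {X : Type*} (H : Set (X → Bool)) : ℕ∞ :=
  ⨆ (T : ℕ) (_ : ∃ t : CompleteTree X T, t.Shattered (fun h x y => h x = y) H), (T : ℕ∞)

/-- A distribution `P` over `X` is `ε`-good with respect to `H` if
`Pr_{x ∼ P}[h x = 1] ∈ [0, ε] ∪ [1 - ε, 1]` for every `h ∈ H`. -/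
def IsGood {X : Type*} [MeasurableSpace X] (H : Set (X → Bool)) (ε : ℝ)
    (P : ProbabilityMeasure X) : Prop :=
  ∀ h ∈ H, (P : Measure X).real {x | h x = true} ∈ Set.Icc 0 ε ∪ Set.Icc (1 - ε) 1

/-- The distributions over `X` that are `ε`-good with respect to `H`. -/
abbrev GoodDistribution {X : Type*} [MeasurableSpace X] (H : Set (X → Bool)) (ε : ℝ) : Type _ :=
  {P : ProbabilityMeasure X // IsGood H ε P}

/-- The supremum `d_ε` of the depths of the complete `ε`-good trees (nodes labelled by `ε`-good
distributions) shattered by `H`; at a node labelled `P` the hypothesis `h` goes in direction `y`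
if `Pr_{x ∼ P}[h x = y] ≥ 1 - ε`. -/
noncomputable def goodDim {X : Type*} [MeasurableSpace X] (H : Set (X → Bool)) (ε : ℝ) : ℕ∞ :=
  ⨆ (T : ℕ) (_ : ∃ t : CompleteTree (GoodDistribution H ε) T,
    t.Shattered (fun h P y => 1 - ε ≤ (P.1 : Measure X).real {x | h x = y}) H), (T : ℕ∞)

end GoodTree

/-! Put `γ = 1/2 - ε`. For the upper bound, run a randomized halving strategy over a weighted family
of version spaces, each with a rank exceeding its Littlestone dimension. At every point one of the
two answers lowers the rank (`exists_not_shatters_restrict`). At each node follow a direction `y`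
agreeing, with probability at least `1/2`, with the rank-lowering answer for version spaces carrying
at least half the weight. Halve those and split them over the random point: the total weight shrinks
by `3/4` (`exists_direction`). A hypothesis following the branch agrees with `y` with probability at
least `1/2 + γ`, so a fraction `γ` of each split survives for it. The potential `(γ/2)^(rank - 1)`
absorbs the loss `γ/2` (`update_mass_le`), so `(γ/2)^d ≤ (3/4)^T`. For `ε = 0`, point masses give
one inequality; for the other, finitely many almost surely constant hypotheses take their constants
at a common point. -/

namespace GoodTree

/-! ### Rank recursion for shattering -/

/-- `H` shatters some complete `X`-labelled tree of depth `n`. -/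
def Shatters {X : Type*} (H : Set (X → Bool)) (n : ℕ) : Prop :=
  ∃ t : CompleteTree X n, t.Shattered (fun h x y => h x = y) H

theorem not_shatters_empty {X : Type*} (n : ℕ) : ¬ Shatters (∅ : Set (X → Bool)) n := by
  rintro ⟨t, ht⟩
  obtain ⟨h, hh, -⟩ := ht fun _ => false
  exact hh

theorem shatters_zero {X : Type*} {H : Set (X → Bool)} {h : X → Bool} (hh : h ∈ H) :
    Shatters H 0 :=
  ⟨.leaf, fun _ => ⟨h, hh, by simp [CompleteTree.branch]⟩⟩

theorem Shatters.succ {X : Type*} {H : Set (X → Bool)} {n : ℕ} (x : X)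
    (hx : ∀ s, Shatters {h ∈ H | h x = s} n) : Shatters H (n + 1) := by
  obtain ⟨l, hl⟩ := hx false
  obtain ⟨r, hr⟩ := hx true
  refine ⟨.node x l r, fun y => ?_⟩
  cases hy : y 0
  · obtain ⟨h, hh, hb⟩ := hl (Fin.tail y)
    refine ⟨h, hh.1, fun p hp => ?_⟩
    simp only [CompleteTree.branch, hy, cond_false, List.mem_cons] at hp
    rcases hp with rfl | hp
    exacts [hh.2, hb p hp]
  · obtain ⟨h, hh, hb⟩ := hr (Fin.tail y)
    refine ⟨h, hh.1, fun p hp => ?_⟩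
    simp only [CompleteTree.branch, hy, cond_true, List.mem_cons] at hp
    rcases hp with rfl | hp
    exacts [hh.2, hb p hp]

/-- Otherwise the trees for the two answers could be joined under `x`. At `n = 0` the truncated
subtraction is harmless: `H` is empty, hence so are its restrictions. -/
theorem exists_not_shatters_restrict {X : Type*} {H : Set (X → Bool)} {n : ℕ}
    (hH : ¬ Shatters H n) (x : X) : ∃ s, ¬ Shatters {h ∈ H | h x = s} (n - 1) := by
  by_contra! hx
  cases n with
  | zero =>
    obtain ⟨t, ht⟩ := hx true
    obtain ⟨h, hh, -⟩ := ht fun _ => false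
    exact hH (shatters_zero hh.1)
  | succ n => exact hH (Shatters.succ x hx)

theorem Shatters.le_of_Ldim {X : Type*} {H : Set (X → Bool)} {n d : ℕ} (hH : Shatters H n)
    (hd : Ldim H = d) : n ≤ d := by
  have h : (n : ℕ∞) ≤ Ldim H := le_iSup₂ (f := fun (T : ℕ) (_ : Shatters H T) => (T : ℕ∞)) n hH
  rw [hd] at h
  exact_mod_cast h

/-! ### Relabelling trees and the case `ε = 0` -/

/-- The relabelled tree. -/
def CompleteTree.map {α β : Type*} (f : α → β) : {T : ℕ} → CompleteTree α T → CompleteTree β T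
  | _, .leaf => .leaf
  | _, .node a l r => .node (f a) (l.map f) (r.map f)

theorem CompleteTree.branch_map {α β : Type*} (f : α → β) {T : ℕ} (t : CompleteTree α T)
    (y : Fin T → Bool) : (t.map f).branch y = (t.branch y).map (Prod.map f id) := by
  induction t with
  | leaf => rfl
  | node a l r ihl ihr =>
    cases hy : y 0 <;> simp [CompleteTree.map, CompleteTree.branch, hy, ihl, ihr]

theorem CompleteTree.Shattered.map {X α β : Type*} {T : ℕ} {t : CompleteTree α T}
    {R : (X → Bool) → α → Bool → Prop} {R' : (X → Bool) → β → Bool → Prop} {H : Set (X → Bool)}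
    (ht : t.Shattered R H) (f : α → β) (hf : ∀ h ∈ H, ∀ a y, R h a y → R' h (f a) y) :
    (t.map f).Shattered R' H := by
  intro y
  obtain ⟨h, hh, hb⟩ := ht y
  refine ⟨h, hh, fun p hp => ?_⟩
  rw [CompleteTree.branch_map, List.mem_map] at hp
  obtain ⟨q, hq, rfl⟩ := hp
  exact hf h hh _ _ (hb q hq)

theorem CompleteTree.Shattered.mono {X α : Type*} {T : ℕ} {t : CompleteTree α T}
    {R : (X → Bool) → α → Bool → Prop} {H H' : Set (X → Bool)}
    (ht : t.Shattered R H) (hH : H ⊆ H') : t.Shattered R H' := fun y =>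
  let ⟨h, hh, hb⟩ := ht y
  ⟨h, hH hh, hb⟩

/-- One witness per branch suffices. Finiteness keeps the union of exceptional null sets null. -/
theorem CompleteTree.Shattered.exists_finite {X α : Type*} {T : ℕ} {t : CompleteTree α T}
    {R : (X → Bool) → α → Bool → Prop} {H : Set (X → Bool)} (ht : t.Shattered R H) :
    ∃ H' ⊆ H, H'.Finite ∧ t.Shattered R H' := by
  choose h hh hb using ht
  exact ⟨Set.range h, Set.range_subset_iff.2 hh, Set.finite_range h,
    fun y => ⟨h y, ⟨y, rfl⟩, hb y⟩⟩

/-- If finitely many hypotheses are almost surely constant, some point realizes all the constants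
at once. -/
theorem exists_point_of_finite {X : Type*} [MeasurableSpace X] {H : Set (X → Bool)}
    (hfin : H.Finite) (hm : ∀ h ∈ H, Measurable h) (P : ProbabilityMeasure X) :
    ∃ x, ∀ h ∈ H, ∀ y, 1 - 0 ≤ (P : Measure X).real {x | h x = y} → h x = y := by
  have hae : ∀ᵐ x ∂(P : Measure X), ∀ h ∈ H, ∀ y,
      1 - 0 ≤ (P : Measure X).real {x | h x = y} → h x = y := by
    rw [ae_ball_iff hfin.countable]
    intro h hh
    rw [ae_all_iff]
    intro y
    by_cases hy : 1 - 0 ≤ (P : Measure X).real {x | h x = y}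
    · have hms : MeasurableSet {x | h x = y} := hm h hh (measurableSet_singleton y)
      have h1 : (P : Measure X).real {x | h x = y} = 1 :=
        le_antisymm measureReal_le_one (by linarith)
      have h2 : (P : Measure X) {x | h x = y} = 1 := by
        rwa [measureReal_def, ENNReal.toReal_eq_one_iff] at h1
      filter_upwards [(prob_compl_eq_zero_iff hms).2 h2] with x hx _ using hx
    · exact Filter.Eventually.of_forall fun x hx => absurd hx hy
  exact hae.exists

theorem goodDim_zero_le {X : Type*} [MeasurableSpace X] {H : Set (X → Bool)}
    (hm : ∀ h ∈ H, Measurable h) : goodDim H 0 ≤ Ldim H := by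
  refine iSup₂_le fun T hT => ?_
  obtain ⟨t, ht⟩ := hT
  obtain ⟨H', hH', hfin, ht'⟩ := ht.exists_finite
  choose f hf using fun P : GoodDistribution H 0 =>
    exists_point_of_finite hfin (fun h hh => hm h (hH' hh)) P.1
  have hs : (t.map f).Shattered (fun h x y => h x = y) H :=
    (ht'.map f fun h hh P y hR => hf P h hh y hR).mono hH'
  exact le_iSup₂ (f := fun (T : ℕ) (_ : Shatters H T) => (T : ℕ∞)) T ⟨_, hs⟩

/-- Point masses are `0`-good with respect to measurable hypotheses. -/
theorem isGood_dirac {X : Type*} [MeasurableSpace X] {H : Set (X → Bool)}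
    (hm : ∀ h ∈ H, Measurable h) (x : X) :
    IsGood H 0 (⟨Measure.dirac x, inferInstance⟩ : ProbabilityMeasure X) := by
  intro h hh
  have hms : MeasurableSet {x | h x = true} := hm h hh (measurableSet_singleton true)
  change (Measure.dirac x).real _ ∈ _
  rw [measureReal_def, Measure.dirac_apply' _ hms]
  by_cases hx : h x = true <;> simp [hx]

theorem Ldim_le_goodDim_zero {X : Type*} [MeasurableSpace X] {H : Set (X → Bool)}
    (hm : ∀ h ∈ H, Measurable h) : Ldim H ≤ goodDim H 0 := by
  refine iSup₂_le fun T hT => ?_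
  obtain ⟨t, ht⟩ := hT
  have hs := ht.map (R' := fun h (P : GoodDistribution H 0) y =>
    1 - 0 ≤ (P.1 : Measure X).real {x | h x = y}) (fun x => ⟨_, isGood_dirac hm x⟩) (by
      intro h hh x y hxy
      have hms : MeasurableSet {x | h x = y} := hm h hh (measurableSet_singleton y)
      change _ ≤ (Measure.dirac x).real _
      rw [measureReal_def, Measure.dirac_apply' _ hms]
      simp [hxy])
  exact le_iSup₂ (f := fun (T : ℕ) (_ : ∃ t : CompleteTree (GoodDistribution H 0) T,
    t.Shattered (fun h P y => 1 - 0 ≤ (P.1 : Measure X).real {x | h x = y}) H) => (T : ℕ∞))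
    T ⟨_, hs⟩

/-! ### Weighted version spaces and the potential -/

section Potential

universe u

variable {X : Type*} {Ω : Type u} [Fintype Ω]

open Classical in
/-- One version space `V` of rank `n`, updated by the answers `y` at random points `pt ω` drawn
with probabilities `q ω`: the mass of `h` in the updates is at least `γ` times the mass of `h`
in `V`. -/
theorem update_mass_le {γ c : ℝ} (hγ : 0 < γ) (hc : 0 ≤ c) (pt : Ω → X) (q : Ω → ℝ)
    (q_nonneg : ∀ ω, 0 ≤ q ω) (q_sum : ∑ ω, q ω = 1) {V : Set (X → Bool)} {n : ℕ}
    (g : Ω → Bool)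
    (hg : ∀ ω, ¬ Shatters {h ∈ V | h (pt ω) = g ω} (n - 1)) (y : Bool)
    (hy : 1 / 2 ≤ ∑ ω, if g ω = y then q ω else 0) (h : X → Bool)
    (hh : 1 / 2 + γ ≤ ∑ ω, if h (pt ω) = y then q ω else 0) :
    (if h ∈ V then (c * γ) ^ (n - 1) else 0) ≤
      ∑ ω, c * q ω *
        (if h ∈ {h ∈ V | g ω = y ∧ h (pt ω) = y} then (c * γ) ^ (n - 1 - 1) else 0) := by
  by_cases hhV : h ∈ V
  swap
  · simp [hhV]
  -- Events of probability at least `1/2` and `1/2 + γ` overlap in at least `γ`.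
  have key : γ ≤ ∑ ω, if g ω = y ∧ h (pt ω) = y then q ω else 0 := by
    have h1 : ∑ ω, ((if g ω = y then q ω else 0) + (if h (pt ω) = y then q ω else 0)) ≤
        ∑ ω, (q ω + if g ω = y ∧ h (pt ω) = y then q ω else 0) := by
      refine Finset.sum_le_sum fun ω _ => ?_
      have := q_nonneg ω
      by_cases h1 : g ω = y <;> by_cases h2 : h (pt ω) = y <;> simp [h1, h2, this]
    rw [Finset.sum_add_distrib, Finset.sum_add_distrib, q_sum] at h1
    linarith
  have hsum : ∑ ω, c * q ω *
        (if h ∈ {h ∈ V | g ω = y ∧ h (pt ω) = y} then (c * γ) ^ (n - 1 - 1) else 0) =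
      c * (c * γ) ^ (n - 1 - 1) * ∑ ω, if g ω = y ∧ h (pt ω) = y then q ω else 0 := by
    rw [Finset.mul_sum]
    refine Finset.sum_congr rfl fun ω _ => ?_
    by_cases h1 : g ω = y ∧ h (pt ω) = y
    · rw [if_pos ⟨hhV, h1⟩, if_pos h1]; ring
    · rw [if_neg fun h2 => h1 h2.2, if_neg h1]; simp
  rw [hsum, if_pos hhV]
  have hpow : 0 ≤ c * (c * γ) ^ (n - 1 - 1) := by positivity
  -- For `n ≤ 1` the truncated exponent cannot drop, but then every rank-lowering restriction is
  -- empty, contradicting the positive overlap.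
  by_cases hn : 2 ≤ n
  · calc (c * γ) ^ (n - 1) = c * (c * γ) ^ (n - 1 - 1) * γ := by
          obtain ⟨m, rfl⟩ := Nat.exists_eq_add_of_le' hn
          simp only [Nat.add_succ_sub_one, Nat.add_sub_cancel, pow_succ]
          ring
      _ ≤ _ := mul_le_mul_of_nonneg_left key hpow
  · have hzero : n - 1 = 0 := by omega
    have hnone : ∀ ω, ¬ (g ω = y ∧ h (pt ω) = y) := by
      rintro ω ⟨h1, h2⟩
      refine hg ω ?_
      rw [hzero]
      exact shatters_zero (h := h) ⟨hhV, h2.trans h1.symm⟩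
    have : γ ≤ 0 := by simpa [hnone] using key
    linarith

open Classical in
/-- Some direction `y` is the unlikely answer for at least half of the weight. -/
theorem exists_direction {ι : Type*} [Fintype ι] (w : ι → ℝ) (w_nonneg : ∀ i, 0 ≤ w i)
    (q : Ω → ℝ) (q_sum : ∑ ω, q ω = 1) (g : ι → Ω → Bool) :
    ∃ y, ∑ i, w i * (if 1 / 2 ≤ ∑ ω, (if g i ω = y then q ω else 0) then 1 / 2 else 1) ≤
      3 / 4 * ∑ i, w i := by
  by_contra! hlt
  have hsum : ∑ i, w i * (if 1 / 2 ≤ ∑ ω, (if g i ω = true then q ω else 0) then 1 / 2 else 1) +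
      ∑ i, w i * (if 1 / 2 ≤ ∑ ω, (if g i ω = false then q ω else 0) then 1 / 2 else 1) ≤
      3 / 2 * ∑ i, w i := by
    -- For each `i` the two probabilities sum to `1`, so some direction has factor `1/2`; the two
    -- factors average at most `3/4`.
    rw [← Finset.sum_add_distrib, Finset.mul_sum]
    refine Finset.sum_le_sum fun i _ => ?_
    have hq : ∑ ω, (if g i ω = true then q ω else 0) + ∑ ω, (if g i ω = false then q ω else 0) =
        1 := by
      rw [← Finset.sum_add_distrib, ← q_sum]
      refine Finset.sum_congr rfl fun ω _ => ?_
      cases g i ω <;> simp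
    have := w_nonneg i
    split_ifs <;> linarith
  have h1 := hlt true
  have h2 := hlt false
  linarith

open Classical in
/-- Against every weighted family of version spaces, a tree of depth `T` has a branch along which
the total weight shrinks by the factor `(3 / 4) ^ T`, while it bounds the mass of every hypothesis
that follows the branch with margin `γ`. -/
theorem exists_branch_mass_le {α : Type*} {γ : ℝ} (hγ : 0 < γ) (hγ' : γ ≤ 1 / 2) (pt : Ω → X)
    (p : α → Ω → ℝ) (p_nonneg : ∀ a ω, 0 ≤ p a ω) (p_sum : ∀ a, ∑ ω, p a ω = 1)
    {T : ℕ} (t : CompleteTree α T) :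
    ∀ (ι : Type u) [Fintype ι] (V : ι → Set (X → Bool)) (n : ι → ℕ) (w : ι → ℝ),
      (∀ i, 0 ≤ w i) → (∀ i, ¬ Shatters (V i) (n i)) →
      ∃ y, ∀ h : X → Bool,
        (∀ r ∈ t.branch y, 1 / 2 + γ ≤ ∑ ω, if h (pt ω) = r.2 then p r.1 ω else 0) →
        ∑ i, w i * (if h ∈ V i then (1 / 2 * γ) ^ (n i - 1) else 0) ≤ (3 / 4) ^ T * ∑ i, w i := by
  induction t with
  | leaf =>
    intro ι _ V n w hw _
    refine ⟨fun _ => false, fun h _ => ?_⟩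
    rw [pow_zero, one_mul]
    refine Finset.sum_le_sum fun i _ => mul_le_of_le_one_right (hw i) ?_
    split_ifs
    · exact pow_le_one₀ (by positivity) (by linarith)
    · exact zero_le_one
  | @node T a l r ihl ihr =>
    intro ι _ V n w hw hV
    choose g hg using fun i ω => exists_not_shatters_restrict (hV i) (pt ω)
    obtain ⟨y, hy⟩ := exists_direction w hw (p a) (p_sum a) g
    set wrong : ι → Prop := fun i => 1 / 2 ≤ ∑ ω, if g i ω = y then p a ω else 0
    -- Requiring `g = y` empties the copies whose rank would not drop, so rank `n - 1` is valid for
    -- all copies of a wrong version space.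
    let V' : ι × Ω → Set (X → Bool) := fun k =>
      if wrong k.1 then {h ∈ V k.1 | g k.1 k.2 = y ∧ h (pt k.2) = y} else V k.1
    let n' : ι × Ω → ℕ := fun k => if wrong k.1 then n k.1 - 1 else n k.1
    let w' : ι × Ω → ℝ := fun k => w k.1 * (if wrong k.1 then 1 / 2 else 1) * p a k.2
    have hw' : ∀ k, 0 ≤ w' k := fun k =>
      mul_nonneg (mul_nonneg (hw _) (by split_ifs <;> norm_num)) (p_nonneg _ _)
    have hV' : ∀ k, ¬ Shatters (V' k) (n' k) := by
      rintro ⟨i, ω⟩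
      by_cases hi : wrong i
      · simp only [V', n', hi, if_true]
        by_cases hgy : g i ω = y
        · simpa [hgy] using hg i ω
        · simpa [hgy] using not_shatters_empty (X := X) _
      · simpa [V', n', hi] using hV i
    have hW : ∑ k, w' k ≤ 3 / 4 * ∑ i, w i := by
      rw [Fintype.sum_prod_type]
      refine (Finset.sum_congr rfl fun i _ => ?_).trans_le hy
      by_cases hi : wrong i
      · simp only [w', hi, if_true]
        rw [← Finset.mul_sum, p_sum, mul_one, if_pos hi]
      · simp only [w', hi, if_false]
        rw [← Finset.mul_sum, p_sum, mul_one, if_neg hi]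
    have hmass : ∀ h : X → Bool,
        1 / 2 + γ ≤ ∑ ω, (if h (pt ω) = y then p a ω else 0) →
        ∑ i, w i * (if h ∈ V i then (1 / 2 * γ) ^ (n i - 1) else 0) ≤
          ∑ k, w' k * (if h ∈ V' k then (1 / 2 * γ) ^ (n' k - 1) else 0) := by
      intro h hh
      rw [Fintype.sum_prod_type]
      refine Finset.sum_le_sum fun i _ => ?_
      by_cases hi : wrong i
      · simp only [w', V', n', hi, if_true]
        refine (mul_le_mul_of_nonneg_left (update_mass_le hγ (by norm_num : (0 : ℝ) ≤ 1 / 2) pt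
          (p a) (p_nonneg a) (p_sum a) (g i) (hg i) y hi h hh) (hw i)).trans_eq ?_
        rw [Finset.mul_sum]
        exact Finset.sum_congr rfl fun ω _ => by ring
      · simp only [w', V', n', hi, if_false, mul_one]
        rw [← Finset.sum_mul, ← Finset.mul_sum, p_sum, mul_one]
    have hstep : ∀ (b : CompleteTree α T), (∃ z, ∀ h : X → Bool,
        (∀ r ∈ b.branch z, 1 / 2 + γ ≤ ∑ ω, if h (pt ω) = r.2 then p r.1 ω else 0) →
        ∑ k, w' k * (if h ∈ V' k then (1 / 2 * γ) ^ (n' k - 1) else 0) ≤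
          (3 / 4) ^ T * ∑ k, w' k) →
        ∃ z, ∀ h : X → Bool, (∀ r ∈ (a, y) :: b.branch z,
          1 / 2 + γ ≤ ∑ ω, if h (pt ω) = r.2 then p r.1 ω else 0) →
        ∑ i, w i * (if h ∈ V i then (1 / 2 * γ) ^ (n i - 1) else 0) ≤
          (3 / 4) ^ (T + 1) * ∑ i, w i := by
      rintro b ⟨z, hz⟩
      refine ⟨z, fun h hh => ?_⟩
      calc _ ≤ _ := hmass h (hh _ List.mem_cons_self)
        _ ≤ (3 / 4) ^ T * ∑ k, w' k := hz h fun r hr => hh r (List.mem_cons_of_mem _ hr)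
        _ ≤ (3 / 4) ^ T * (3 / 4 * ∑ i, w i) := by gcongr
        _ = _ := by ring
    cases y
    · obtain ⟨z, hz⟩ := hstep l (ihl _ V' n' w' hw' hV')
      exact ⟨Fin.cons false z, by simpa [CompleteTree.branch] using hz⟩
    · obtain ⟨z, hz⟩ := hstep r (ihr _ V' n' w' hw' hV')
      exact ⟨Fin.cons true z, by simpa [CompleteTree.branch] using hz⟩

/-- The depth of a tree shattered with margin `γ` by a class of Littlestone dimension `d`,
in exponential form. -/
theorem pow_le_pow_of_shattered {α : Type*} {γ : ℝ} (hγ : 0 < γ) (hγ' : γ ≤ 1 / 2) (pt : Ω → X)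
    (p : α → Ω → ℝ) (p_nonneg : ∀ a ω, 0 ≤ p a ω) (p_sum : ∀ a, ∑ ω, p a ω = 1)
    {H : Set (X → Bool)} {d : ℕ} (hd : ¬ Shatters H (d + 1)) {T : ℕ} {t : CompleteTree α T}
    (ht : t.Shattered
      (fun h a y => 1 / 2 + γ ≤ ∑ ω, if h (pt ω) = y then p a ω else 0) H) :
    (1 / 2 * γ) ^ d ≤ (3 / 4) ^ T := by
  obtain ⟨y, hy⟩ := exists_branch_mass_le hγ hγ' pt p p_nonneg p_sum t PUnit (fun _ => H)
    (fun _ => d + 1) (fun _ => 1) (fun _ => zero_le_one) (fun _ => hd)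
  obtain ⟨h, hh, hb⟩ := ht y
  simpa [hh] using hy h hb

end Potential

/-! ### Numerical bound and reduction to finitely many points -/

theorem depth_le_of_pow_le_pow {γ : ℝ} (hγ : 0 < γ) (hγ' : γ ≤ 1 / 2) {d T : ℕ}
    (h : (1 / 2 * γ) ^ d ≤ (3 / 4 : ℝ) ^ T) : (T : ℝ) ≤ 4 * (d / γ ^ 2) := by
  have hlog := Real.log_le_log (by positivity) h
  rw [Real.log_pow, Real.log_pow] at hlog
  have h1 : Real.log (3 / 4) ≤ -(1 / 4) := by
    have := Real.log_le_sub_one_of_pos (x := 3 / 4) (by norm_num)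
    linarith
  have h2 : -(1 / γ ^ 2) ≤ Real.log (1 / 2 * γ) := by
    have := Real.one_sub_inv_le_log_of_pos (x := 1 / 2 * γ) (by positivity)
    -- This is `γ ≤ 1/2`; it crudely replaces the logarithm of `2/γ` by `1/γ²`.
    have h3 : (1 / 2 * γ)⁻¹ ≤ 1 / γ ^ 2 := by
      rw [← one_div, one_div_le_one_div (by positivity) (by positivity)]
      nlinarith
    linarith
  have h4 := mul_le_mul_of_nonneg_left h1 T.cast_nonneg (α := ℝ)
  have h5 := mul_le_mul_of_nonneg_left h2 d.cast_nonneg (α := ℝ)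
  have h6 : (d : ℝ) / γ ^ 2 = d * (1 / γ ^ 2) := by ring
  rw [h6]
  linarith

theorem CompleteTree.Shattered.depth_le {X : Type*} [MeasurableSpace X] {H : Set (X → Bool)}
    (hm : ∀ h ∈ H, Measurable h) {d : ℕ} (hd : Ldim H = d) {ε : ℝ} (hε : 0 ≤ ε)
    (hε' : ε < 1 / 2) {T : ℕ} {t : CompleteTree (GoodDistribution H ε) T}
    (ht : t.Shattered (fun h P y => 1 - ε ≤ (P.1 : Measure X).real {x | h x = y}) H) :
    (T : ℝ) ≤ 4 * (d / (1 / 2 - ε) ^ 2) := by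
  cases isEmpty_or_nonempty X
  · cases t with
    | leaf => simp only [CharP.cast_eq_zero]; positivity
    | node a l r => exact isEmptyElim a.1.nonempty.some
  choose f hfH hfb using ht
  -- The witnesses see a point only through its answer pattern, so each distribution becomes weights
  -- on finitely many patterns. `Function.invFun φ` picks a representative point; unattained
  -- patterns have weight `0`.
  let φ : X → (Fin T → Bool) → Bool := fun x b => f b x
  have hφ : Measurable φ := measurable_pi_lambda _ fun b => hm _ (hfH b)
  have hpt : ∀ x b, f b (Function.invFun φ (φ x)) = f b x := fun x b =>
    congrFun (Function.invFun_eq (f := φ) ⟨x, rfl⟩) b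
  have hsum : ∀ (P : ProbabilityMeasure X) (s : Finset ((Fin T → Bool) → Bool)),
      ∑ ω ∈ s, (P : Measure X).real (φ ⁻¹' {ω}) = (P : Measure X).real (φ ⁻¹' s) := fun P s =>
    sum_measureReal_preimage_singleton s fun ω _ => hφ (measurableSet_singleton ω)
  refine depth_le_of_pow_le_pow (by linarith) (by linarith)
    (pow_le_pow_of_shattered (t := t) (H := H) (by linarith) (by linarith) (Function.invFun φ)
      (fun P ω => (P.1 : Measure X).real (φ ⁻¹' {ω})) (fun _ _ => measureReal_nonneg) ?_
      (fun hs => absurd (hs.le_of_Ldim hd) (by omega)) fun y => ⟨f y, hfH y, fun r hr => ?_⟩)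
  · intro P
    rw [hsum, Finset.coe_univ, Set.preimage_univ, probReal_univ]
  · have hpre : φ ⁻¹' (Finset.univ.filter fun ω => f y (Function.invFun φ ω) = r.2 : Finset _) =
        {x | f y x = r.2} := by
      ext x
      simp [hpt]
    beta_reduce
    rw [← Finset.sum_filter, hsum, hpre]
    linarith [hfb y r hr]

end GoodTree

theorem corollaryc :
    ∃ C : ℝ, 0 < C ∧
      ∀ (X : Type*) [MeasurableSpace X] (H : Set (X → Bool)) (_ : ∀ h ∈ H, Measurable h)
        (d : ℕ) (_ : GoodTree.Ldim H = d),
        GoodTree.goodDim H 0 = d ∧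
        ∀ ε : ℝ, 0 ≤ ε → ε < 1 / 2 →
          ∃ n : ℕ, GoodTree.goodDim H ε = n ∧ (n : ℝ) ≤ C * (d / (1 / 2 - ε) ^ 2) := by
  refine ⟨4, by norm_num, fun X _ H hm d hd => ⟨?_, fun ε hε hε' => ?_⟩⟩
  · rw [← hd]
    exact le_antisymm (GoodTree.goodDim_zero_le hm) (GoodTree.Ldim_le_goodDim_zero hm)
  · have hle : GoodTree.goodDim H ε ≤ (⌊4 * ((d : ℝ) / (1 / 2 - ε) ^ 2)⌋₊ : ℕ) := by
      refine iSup₂_le fun T hT => ?_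
      obtain ⟨t, ht⟩ := hT
      exact_mod_cast Nat.le_floor (ht.depth_le hm hd hε hε')
    obtain ⟨n, hn⟩ := ENat.ne_top_iff_exists.1 (ne_top_of_le_ne_top (ENat.natCast_ne_top _) hle)
    refine ⟨n, hn.symm, ?_⟩
    rw [← hn] at hle
    exact (Nat.le_floor_iff (by positivity)).1 (by exact_mod_cast hle)
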